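/- Let $V$ be a real vector space of finite dimension $n$, and let $\mathcal K(V)$ be the set of non-empty convex compact subsets of $V$ with the Hausdorff metric. A function $\phi:\mathcal K(V)\to\mathbb C$ is a valuation if $\phi(K_1\cup K_2)=\phi(K_1)+\phi(K_2)-\phi(K_1\cap K_2)$ whenever $K_1,K_2,K_1\cup K_2\in\mathcal K(V)$. Let $QV(V)$ be the space of continuous valuations $\phi$ for which $K\mapsto[(t,x)\mapsto\phi(tK+x)]$ is a continuous map $\mathcal K(V)\to C^n([0,1]\times V)$, where $C^n([0,1]\times V)$ has the topology of uniform convergence on compact sets of all derivatives of order at most $n$. Equip $QV(V)$ with the seminorms $$\|\phi\|_G=\sup\{\|\phi(tK+x)\|_{C^n([0,1]\times G)} : K\in\mathcal K(V),\ K\subset G\},\qquad G\subset V\ \text{compact}.$$ The group $\mathrm{Aff}(V)$ of affine automorphisms of $V$ acts on $QV(V)$ by $(g\phi)(K)=\phi(g^{-1}K)$. Let $SV(V)\subset QV(V)$ be the subspace of smooth valuations, i.e. of those $\phi$ for which the map $g\mapsto g\phi$ from the Lie group $\mathrm{Aff}(V)$ to $QV(V)$ is infinitely differentiable. For $i\ge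 0$ set $$W_i=\Big\{\phi\in SV(V) : \frac{d^k}{dt^k}\phi(tK+x)\Big|_{t=0}=0\ \text{ for all } 0\le k<i,\ K\in\mathcal K(V),\ x\in V\Big\}$$ (one-sided derivatives at $0$ of functions of $t\in[0,1]$). **Proposition.** $W_{n+1}=0$. That is, if $\phi$ is a smooth valuation on $V$ such that for all $K\in\mathcal K(V)$ and $x\in V$ the derivatives in $t$ of $\phi(tK+x)$ at $t=0$ of all orders $0,1,\dots,n$ vanish, then $\phi$ is identically zero. -/

import Mathlib

open Set Filter Topology
open scoped Pointwise

noncomputable section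

namespace ConvexVal

/-! ### Convex bodies and affine images

`ConvexBody V` is the set of non-empty compact convex subsets of `V` with the Hausdorff metric. -/

section Bodies

variable {V : Type*} [NormedAddCommGroup V] [NormedSpace ℝ V]

/-- The one-point convex body `{x}`. -/
def pt (x : V) : ConvexBody V :=
  ⟨{x}, convex_singleton x, isCompact_singleton, singleton_nonempty x⟩

/-- The convex body `tK + x`, for `p = (t, x)`. -/
def dilTrans (K : ConvexBody V) (p : ℝ × V) : ConvexBody V := p.1 • K + pt p.2

theorem coe_dilTrans (K : ConvexBody V) (p : ℝ × V) :
    (dilTrans K p : Set V) = (fun y => p.1 • y + p.2) '' (K : Set V) := by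
  have h : ((pt p.2 : ConvexBody V) : Set V) = {p.2} := rfl
  rw [dilTrans, ConvexBody.coe_add, ConvexBody.coe_smul, h, Set.add_singleton, ← Set.image_smul,
    Set.image_image]

/-- The image of a convex body under an affine automorphism of `V`. -/
def image [FiniteDimensional ℝ V] (g : V ≃ᵃ[ℝ] V) (K : ConvexBody V) : ConvexBody V where
  carrier := g '' (K : Set V)
  convex' := K.convex.affine_image g.toAffineMap
  isCompact' := K.isCompact.image g.toAffineMap.continuous_of_finiteDimensional
  nonempty' := K.nonempty.image g

theorem coe_image [FiniteDimensional ℝ V] (g : V ≃ᵃ[ℝ] V) (K : ConvexBody V) :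
    (image g K : Set V) = g '' (K : Set V) := rfl

theorem isCompact_bodies_subset {G : Set V} (hG : IsCompact G) :
    IsCompact {K : ConvexBody V | (K : Set V) ⊆ G} := by
  let ι : ConvexBody V → TopologicalSpace.NonemptyCompacts V :=
    fun K => ⟨⟨K, K.isCompact⟩, K.nonempty⟩
  have hι : Isometry ι := Isometry.of_dist_eq fun K L => rfl
  have hcl : IsClosed (range ι) := by
    rw [← isSeqClosed_iff_isClosed]
    intro u L hu hL
    have hconv : Convex ℝ (L : Set V) := by
      intro x hx y hy a b ha hb hab
      have hcl : IsClosed (L : Set V) := L.isCompact.isClosed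
      rw [hcl.mem_iff_infDist_zero L.nonempty]
      refine le_antisymm (le_of_forall_pos_le_add fun ε hε => ?_) Metric.infDist_nonneg
      have h1 : ∀ᶠ k in atTop, dist (u k) L < ε / 2 :=
        (Metric.tendsto_nhds.1 hL) _ (half_pos hε)
      obtain ⟨k, hk⟩ := h1.exists
      obtain ⟨K, hK⟩ := hu k
      rw [← hK] at hk
      have hfin : Metric.hausdorffEDist (K : Set V) (L : Set V) ≠ ⊤ :=
        Metric.hausdorffEDist_ne_top_of_nonempty_of_bounded K.nonempty L.nonempty
          K.isCompact.isBounded L.isCompact.isBounded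
      have hk' : Metric.hausdorffDist (K : Set V) (L : Set V) < ε / 2 := hk
      obtain ⟨x', hx', hxx⟩ := Metric.exists_dist_lt_of_hausdorffDist_lt' hx hk' hfin
      obtain ⟨y', hy', hyy⟩ := Metric.exists_dist_lt_of_hausdorffDist_lt' hy hk' hfin
      obtain ⟨w, hw, hzw⟩ := Metric.exists_dist_lt_of_hausdorffDist_lt
        (K.convex hx' hy' ha hb hab) hk' hfin
      have h2 : dist (a • x + b • y) (a • x' + b • y') ≤ ε / 2 := by
        rw [dist_eq_norm]
        rw [dist_comm, dist_eq_norm] at hxx hyy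
        have : a • x + b • y - (a • x' + b • y') = a • (x - x') + b • (y - y') := by
          simp only [smul_sub]; abel
        rw [this]
        calc ‖a • (x - x') + b • (y - y')‖ ≤ a * ‖x - x'‖ + b * ‖y - y'‖ := by
              refine (norm_add_le _ _).trans ?_
              rw [norm_smul, norm_smul, Real.norm_of_nonneg ha, Real.norm_of_nonneg hb]
          _ ≤ a * (ε / 2) + b * (ε / 2) := by gcongr
          _ = ε / 2 := by rw [← add_mul, hab, one_mul]
      calc Metric.infDist (a • x + b • y) (L : Set V) ≤ dist (a • x + b • y) w :=
            Metric.infDist_le_dist_of_mem hw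
        _ ≤ dist (a • x + b • y) (a • x' + b • y') + dist (a • x' + b • y') w :=
            dist_triangle _ _ _
        _ ≤ 0 + ε := by linarith
    exact ⟨⟨L, hconv, L.isCompact, L.nonempty⟩, rfl⟩
  have hce : IsClosedEmbedding ι := ⟨hι.isEmbedding, hcl⟩
  exact hce.isCompact_preimage (TopologicalSpace.NonemptyCompacts.isCompact_subsets_of_isCompact hG)

theorem continuous_image [FiniteDimensional ℝ V] (g : V ≃ᵃ[ℝ] V) :
    Continuous (image g : ConvexBody V → ConvexBody V) := by
  let ι : ConvexBody V → TopologicalSpace.NonemptyCompacts V :=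
    fun K => ⟨⟨K, K.isCompact⟩, K.nonempty⟩
  have hι : Isometry ι := Isometry.of_dist_eq fun K L => rfl
  rw [hι.isEmbedding.continuous_iff]
  exact (Continuous.nonemptyCompacts_map
    g.toAffineMap.continuous_of_finiteDimensional).comp hι.continuous

end Bodies

/-! ### Quasi-smooth valuations -/

section Valuations

variable {V : Type*} [NormedAddCommGroup V] [NormedSpace ℝ V]

/-- `φ` is a (complex valued) valuation: `φ(K ∪ L) = φ(K) + φ(L) - φ(K ∩ L)` as soon as
`K ∪ L` is convex. (Then `K ∩ L` is automatically non-empty.) -/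
def IsValuation (φ : ConvexBody V → ℂ) : Prop :=
  ∀ K L U I : ConvexBody V, (U : Set V) = (K : Set V) ∪ (L : Set V) →
    (I : Set V) = (K : Set V) ∩ (L : Set V) → φ U = φ K + φ L - φ I

/-- The function `(t, x) ↦ φ(tK + x)`. -/
def profile (φ : ConvexBody V → ℂ) (K : ConvexBody V) : ℝ × V → ℂ := fun p => φ (dilTrans K p)

variable (V) in
/-- The set `[0,1] × V`. -/
def strip : Set (ℝ × V) := Icc 0 1 ×ˢ univ

theorem uniqueDiffOn_strip : UniqueDiffOn ℝ (strip V) :=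
  (uniqueDiffOn_Icc zero_lt_one).prod uniqueDiffOn_univ

/-- The `j`-th total derivative of `(t, x) ↦ φ(tK + x)` on `[0,1] × V`
(one-sided at `t = 0` and `t = 1`). -/
def jet (φ : ConvexBody V → ℂ) (j : ℕ) (K : ConvexBody V) (p : ℝ × V) :
    ContinuousMultilinearMap ℝ (fun _ : Fin j => ℝ × V) ℂ :=
  iteratedFDerivWithin ℝ j (profile φ K) (strip V) p

/-- Continuous valuations `φ` such that `K ↦ [(t, x) ↦ φ(tK + x)]` is a continuous map from the
convex bodies to `C^n([0,1] × V)`, where `n = dim V` and `C^n([0,1] × V)` carries the topology of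
uniform convergence on compact sets of all derivatives of order at most `n`. -/
structure IsQuasiSmooth (φ : ConvexBody V → ℂ) : Prop where
  valuation : IsValuation φ
  cont : Continuous φ
  contDiffOn : ∀ K, ContDiffOn ℝ (Module.finrank ℝ V : ℕ) (profile φ K) (strip V)
  tendsto : ∀ K, ∀ G : Set V, IsCompact G → ∀ j ≤ Module.finrank ℝ V,
    TendstoUniformlyOn (jet φ j) (jet φ j K) (𝓝 K) (Icc 0 1 ×ˢ G)

variable {φ ψ : ConvexBody V → ℂ}

theorem jet_add (hφ : IsQuasiSmooth φ) (hψ : IsQuasiSmooth ψ) {j : ℕ}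
    (hj : j ≤ Module.finrank ℝ V) (K : ConvexBody V) {p : ℝ × V} (hp : p ∈ strip V) :
    jet (φ + ψ) j K p = jet φ j K p + jet ψ j K p := by
  have hj' : (j : WithTop ℕ∞) ≤ (Module.finrank ℝ V : ℕ) := by exact_mod_cast hj
  exact iteratedFDerivWithin_add_apply (((hφ.contDiffOn K).of_le hj') p hp)
    (((hψ.contDiffOn K).of_le hj') p hp) uniqueDiffOn_strip hp

theorem jet_smul (hφ : IsQuasiSmooth φ) (c : ℂ) {j : ℕ}
    (hj : j ≤ Module.finrank ℝ V) (K : ConvexBody V) {p : ℝ × V} (hp : p ∈ strip V) :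
    jet (c • φ) j K p = c • jet φ j K p := by
  have hj' : (j : WithTop ℕ∞) ≤ (Module.finrank ℝ V : ℕ) := by exact_mod_cast hj
  exact iteratedFDerivWithin_const_smul_apply (((hφ.contDiffOn K).of_le hj') p hp)
    uniqueDiffOn_strip hp

theorem mem_strip_of_mem {V : Type*} {G : Set V} {p : ℝ × V} (hp : p ∈ (Icc 0 1 : Set ℝ) ×ˢ G) :
    p ∈ strip V := ⟨hp.1, trivial⟩

theorem IsQuasiSmooth.zero : IsQuasiSmooth (0 : ConvexBody V → ℂ) where
  valuation := fun K L U I _ _ => by simp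
  cont := continuous_const
  contDiffOn := fun K => contDiffOn_const
  tendsto := fun K G _ j _ => by
    have : ∀ K' : ConvexBody V, jet (0 : ConvexBody V → ℂ) j K' = jet 0 j K := fun K' => rfl
    intro u hu
    refine Eventually.of_forall fun K' p _ => ?_
    rw [this K']
    exact refl_mem_uniformity hu

theorem IsQuasiSmooth.add (hφ : IsQuasiSmooth φ) (hψ : IsQuasiSmooth ψ) :
    IsQuasiSmooth (φ + ψ) where
  valuation := fun K L U I hU hI => by
    simp only [Pi.add_apply, hφ.valuation K L U I hU hI, hψ.valuation K L U I hU hI]; ring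
  cont := hφ.cont.add hψ.cont
  contDiffOn := fun K => (hφ.contDiffOn K).add (hψ.contDiffOn K)
  tendsto := fun K G hG j hj => by
    refine (((hφ.tendsto K G hG j hj).add (hψ.tendsto K G hG j hj)).congr
      (Eventually.of_forall fun K' p hp => ?_)).congr_right fun p hp => ?_
    · exact (jet_add hφ hψ hj K' (mem_strip_of_mem hp)).symm
    · exact (jet_add hφ hψ hj K (mem_strip_of_mem hp)).symm

theorem IsQuasiSmooth.smul (c : ℂ) (hφ : IsQuasiSmooth φ) : IsQuasiSmooth (c • φ) where
  valuation := fun K L U I hU hI => by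
    simp only [Pi.smul_apply, hφ.valuation K L U I hU hI, smul_eq_mul]; ring
  cont := hφ.cont.const_smul c
  contDiffOn := fun K => (hφ.contDiffOn K).const_smul c
  tendsto := fun K G hG j hj => by
    have h := UniformContinuous.comp_tendstoUniformlyOn
      (uniformContinuous_const_smul (M := ℂ)
        (X := ContinuousMultilinearMap ℝ (fun _ : Fin j => ℝ × V) ℂ) c)
      (hφ.tendsto K G hG j hj)
    refine (h.congr (Eventually.of_forall fun K' p hp => ?_)).congr_right fun p hp => ?_
    · exact (jet_smul hφ c hj K' (mem_strip_of_mem hp)).symm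
    · exact (jet_smul hφ c hj K (mem_strip_of_mem hp)).symm

theorem IsQuasiSmooth.exists_bound (hφ : IsQuasiSmooth φ) {G : Set V} (hG : IsCompact G) {j : ℕ}
    (hj : j ≤ Module.finrank ℝ V) :
    ∃ C, ∀ K : ConvexBody V, (K : Set V) ⊆ G → ∀ p ∈ (Icc 0 1 : Set ℝ) ×ˢ G, ‖jet φ j K p‖ ≤ C := by
  have hloc : ∀ K : ConvexBody V, ∃ s ∈ 𝓝 K, ∃ C, ∀ K' ∈ s, ∀ p ∈ (Icc 0 1 : Set ℝ) ×ˢ G,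
      ‖jet φ j K' p‖ ≤ C := by
    intro K
    have hj' : (j : WithTop ℕ∞) ≤ (Module.finrank ℝ V : ℕ) := by exact_mod_cast hj
    have hc : ContinuousOn (jet φ j K) (strip V) :=
      (hφ.contDiffOn K).continuousOn_iteratedFDerivWithin hj' uniqueDiffOn_strip
    obtain ⟨C, hC⟩ := (isCompact_Icc.prod hG).exists_bound_of_continuousOn
      (hc.mono fun p hp => mem_strip_of_mem hp)
    refine ⟨_, Metric.tendstoUniformlyOn_iff.1 (hφ.tendsto K G hG j hj) 1 one_pos, C + 1,
      fun K' hK' p hp => ?_⟩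
    have h1 := hK' p hp
    have h2 := hC p hp
    rw [dist_comm, dist_eq_norm] at h1
    have h3 := norm_le_norm_add_norm_sub' (jet φ j K' p) (jet φ j K p)
    linarith
  have := (isCompact_bodies_subset hG).induction_on
    (p := fun s => ∃ C, ∀ K' ∈ s, ∀ p ∈ (Icc 0 1 : Set ℝ) ×ˢ G, ‖jet φ j K' p‖ ≤ C)
    ⟨0, fun _ h => h.elim⟩
    (fun s t hst ⟨C, hC⟩ => ⟨C, fun K' hK' => hC K' (hst hK')⟩)
    (fun s t ⟨C, hC⟩ ⟨D, hD⟩ => ⟨max C D, fun K' hK' p hp => hK'.elim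
      (fun h => (hC K' h p hp).trans (le_max_left _ _))
      (fun h => (hD K' h p hp).trans (le_max_right _ _))⟩)
    (fun K _ => by
      obtain ⟨s, hs, h⟩ := hloc K
      exact ⟨s, mem_nhdsWithin_of_mem_nhds hs, h⟩)
  obtain ⟨C, hC⟩ := this
  exact ⟨C, fun K hK => hC K hK⟩

theorem contDiffOn_shift {φ : ConvexBody V → ℂ} (hφ : IsQuasiSmooth φ) (K : ConvexBody V) (a : V) :
    ContDiffOn ℝ (Module.finrank ℝ V : ℕ) (fun q => profile φ K ((0, a) + q)) (strip V) :=
  (hφ.contDiffOn K).comp (contDiff_const.add contDiff_id).contDiffOn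
    (fun q hq => ⟨by simpa using hq.1, trivial⟩)

end Valuations

/-! ### The locally convex space `QV(V)` -/

section QVSpace

variable (V : Type*) [NormedAddCommGroup V] [NormedSpace ℝ V]

/-- The linear space of quasi-smooth valuations. -/
def quasiSmooth : Submodule ℂ (ConvexBody V → ℂ) where
  carrier := {φ | IsQuasiSmooth φ}
  zero_mem' := IsQuasiSmooth.zero
  add_mem' := fun h h' => h.add h'
  smul_mem' := fun c _ h => h.smul c

/-- The space `QV(V)` of quasi-smooth valuations. (It is a type of its own because it does not
carry the topology of pointwise convergence.) -/
def QV : Type _ := quasiSmooth V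

instance : AddCommGroup (QV V) := inferInstanceAs (AddCommGroup (quasiSmooth V))

instance : Module ℂ (QV V) := inferInstanceAs (Module ℂ (quasiSmooth V))

instance : CoeFun (QV V) (fun _ => ConvexBody V → ℂ) := ⟨fun φ => Subtype.val φ⟩

variable {V}

theorem QV.isQuasiSmooth (φ : QV V) : IsQuasiSmooth (φ : ConvexBody V → ℂ) := Subtype.property φ

@[ext]
theorem QV.ext {φ ψ : QV V} (h : ∀ K, φ K = ψ K) : φ = ψ := Subtype.ext (funext h)

theorem QV.coe_add (φ ψ : QV V) : ((φ + ψ : QV V) : ConvexBody V → ℂ) = ⇑φ + ⇑ψ := rfl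

theorem QV.coe_smul (c : ℂ) (φ : QV V) : ((c • φ : QV V) : ConvexBody V → ℂ) = c • ⇑φ := rfl

/-- The set of all values `‖D^j φ(tK + x)‖` for convex bodies `K ⊆ G`, `t ∈ [0,1]`, `x ∈ G` and
`j ≤ n = dim V`. -/
def jetNorms (G : Set V) (φ : QV V) : Set ℝ :=
  {r | ∃ K : ConvexBody V, (K : Set V) ⊆ G ∧ ∃ j ≤ Module.finrank ℝ V,
    ∃ p ∈ (Icc 0 1 : Set ℝ) ×ˢ G, r = ‖jet φ j K p‖}

theorem bddAbove_jetNorms {G : Set V} (hG : IsCompact G) (φ : QV V) :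
    BddAbove (jetNorms G φ) := by
  have h : ∀ j, ∃ C, j ≤ Module.finrank ℝ V → ∀ K : ConvexBody V, (K : Set V) ⊆ G →
      ∀ p ∈ (Icc 0 1 : Set ℝ) ×ˢ G, ‖jet φ j K p‖ ≤ C := by
    intro j
    by_cases hj : j ≤ Module.finrank ℝ V
    · obtain ⟨C, hC⟩ := φ.isQuasiSmooth.exists_bound hG hj
      exact ⟨C, fun _ => hC⟩
    · exact ⟨0, fun h => absurd h hj⟩
  choose C hC using h
  refine ⟨∑ j ∈ Finset.range (Module.finrank ℝ V + 1), |C j|, ?_⟩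
  rintro r ⟨K, hK, j, hj, p, hp, rfl⟩
  refine ((hC j hj K hK p hp).trans (le_abs_self _)).trans ?_
  exact Finset.single_le_sum (f := fun j => |C j|) (fun i _ => abs_nonneg _)
    (Finset.mem_range.2 (Nat.lt_succ_of_le hj))

/-- The seminorm `‖φ‖_G = sup {‖φ(tK + x)‖_{C^n([0,1] × G)} : K ⊆ G}` for a compact set `G`. -/
def seminormOn (G : TopologicalSpace.Compacts V) : Seminorm ℂ (QV V) :=
  Seminorm.ofSMulLE (fun φ => sSup (jetNorms (G : Set V) φ))
    (by
      refine le_antisymm (Real.sSup_le ?_ le_rfl) (Real.sSup_nonneg ?_)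
      · rintro r ⟨K, hK, j, hj, p, hp, rfl⟩
        have h := jet_smul (IsQuasiSmooth.zero (V := V)) 0 hj K (mem_strip_of_mem hp)
        rw [zero_smul ℂ (0 : ConvexBody V → ℂ)] at h
        have h' : jet (0 : QV V) j K p = 0 := h.trans (ContinuousMultilinearMap.ext fun v => zero_mul _)
        rw [h', norm_zero]
      · rintro r ⟨K, hK, j, hj, p, hp, rfl⟩
        exact norm_nonneg _)
    (by
      intro φ ψ
      have nn : ∀ χ : QV V, 0 ≤ sSup (jetNorms (G : Set V) χ) := fun χ => Real.sSup_nonneg (by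
        rintro r ⟨K, hK, j, hj, p, hp, rfl⟩
        exact norm_nonneg _)
      refine Real.sSup_le ?_ (add_nonneg (nn φ) (nn ψ))
      rintro r ⟨K, hK, j, hj, p, hp, rfl⟩
      rw [QV.coe_add, jet_add φ.isQuasiSmooth ψ.isQuasiSmooth hj K (mem_strip_of_mem hp)]
      exact (norm_add_le _ _).trans (add_le_add
        (le_csSup (bddAbove_jetNorms G.isCompact φ) ⟨K, hK, j, hj, p, hp, rfl⟩)
        (le_csSup (bddAbove_jetNorms G.isCompact ψ) ⟨K, hK, j, hj, p, hp, rfl⟩)))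
    (by
      intro c φ
      refine Real.sSup_le ?_ (mul_nonneg (norm_nonneg _) (Real.sSup_nonneg (by
        rintro r ⟨K, hK, j, hj, p, hp, rfl⟩
        exact norm_nonneg _)))
      rintro r ⟨K, hK, j, hj, p, hp, rfl⟩
      rw [QV.coe_smul, jet_smul φ.isQuasiSmooth c hj K (mem_strip_of_mem hp), norm_smul]
      exact mul_le_mul_of_nonneg_left
        (le_csSup (bddAbove_jetNorms G.isCompact φ) ⟨K, hK, j, hj, p, hp, rfl⟩) (norm_nonneg _))

theorem seminormOn_apply (G : TopologicalSpace.Compacts V) (φ : QV V) :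
    seminormOn G φ = sSup (jetNorms (G : Set V) φ) := rfl

variable (V) in
/-- The family of all seminorms `‖·‖_G`, `G` compact. -/
def seminorms : SeminormFamily ℂ (QV V) (TopologicalSpace.Compacts V) := seminormOn

/-- `QV(V)` carries the locally convex topology given by the seminorms `‖·‖_G`. -/
instance : TopologicalSpace (QV V) := (seminorms V).moduleFilterBasis.topology

theorem withSeminorms_QV : WithSeminorms (seminorms V) := ⟨rfl⟩

instance : IsTopologicalAddGroup (QV V) := withSeminorms_QV.topologicalAddGroup

instance : ContinuousSMul ℂ (QV V) := withSeminorms_QV.continuousSMul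

end QVSpace

/-! ### The representation of `Aff(V)` -/

section Action

variable {V : Type*} [NormedAddCommGroup V] [NormedSpace ℝ V] [FiniteDimensional ℝ V]

theorem image_dilTrans_linear (g : V ≃ᵃ[ℝ] V) (K : ConvexBody V) (p : ℝ × V) :
    image g (dilTrans K p) =
      dilTrans (image (g.linear.toAffineEquiv) K) (p.1, g.linear p.2 + g 0) := by
  have key : ∀ y, g y = g.linear y + g 0 := fun y => by
    have := g.map_vadd 0 y
    simpa using this
  apply ConvexBody.ext
  simp only [coe_image, coe_dilTrans, Set.image_image]
  refine Set.image_congr fun y _ => ?_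
  rw [key (p.1 • y + p.2), map_add, map_smul, add_assoc]
  rfl

/-- The linear part of `(t, x) ↦ (t, gx)`. -/
def liftLin (g : V ≃ᵃ[ℝ] V) : (ℝ × V) →L[ℝ] (ℝ × V) :=
  (ContinuousLinearMap.id ℝ ℝ).prodMap (LinearMap.toContinuousLinearMap (g.linear : V →ₗ[ℝ] V))

theorem profile_image (φ : ConvexBody V → ℂ) (g : V ≃ᵃ[ℝ] V) (K : ConvexBody V) :
    profile (fun L => φ (image g L)) K =
      (fun q => profile φ (image g.linear.toAffineEquiv K) ((0, g 0) + q)) ∘ liftLin g := by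
  funext p
  simp only [profile, image_dilTrans_linear, Function.comp]
  congr 2
  ext
  · simp [liftLin]
  · simp [liftLin, add_comm]

theorem preimage_strip (g : V ≃ᵃ[ℝ] V) : liftLin g ⁻¹' strip V = strip V := by
  ext q
  simp [liftLin, strip]

theorem jet_image {φ : ConvexBody V → ℂ} (hφ : IsQuasiSmooth φ) (g : V ≃ᵃ[ℝ] V) (K : ConvexBody V)
    {j : ℕ} (hj : j ≤ Module.finrank ℝ V) {p : ℝ × V} (hp : p ∈ strip V) :
    jet (fun L => φ (image g L)) j K p =
      (jet φ j (image g.linear.toAffineEquiv K)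
        ((0, g 0) + liftLin g p)).compContinuousLinearMap (fun _ => liftLin g) := by
  have hj' : (j : WithTop ℕ∞) ≤ (Module.finrank ℝ V : ℕ) := by exact_mod_cast hj
  have hp' : liftLin g p ∈ strip V := by
    have : p ∈ liftLin g ⁻¹' strip V := by rwa [preimage_strip]
    exact this
  have h := ContinuousLinearMap.iteratedFDerivWithin_comp_right (liftLin g)
    (contDiffOn_shift hφ (image g.linear.toAffineEquiv K) (g 0)) uniqueDiffOn_strip
    (by rw [preimage_strip]; exact uniqueDiffOn_strip) hp' hj'
  have hs : ((0, g 0) : ℝ × V) +ᵥ strip V = strip V := by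
    ext q
    rw [Set.mem_vadd_set_iff_neg_vadd_mem]
    simp [strip]
  rw [preimage_strip, iteratedFDerivWithin_comp_add_left, hs] at h
  rw [jet, profile_image, h]
  rfl

theorem IsQuasiSmooth.comp_image {φ : ConvexBody V → ℂ} (hφ : IsQuasiSmooth φ) (g : V ≃ᵃ[ℝ] V) :
    IsQuasiSmooth (fun K => φ (image g K)) where
  valuation := fun K L U I hU hI => by
    refine hφ.valuation _ _ _ _ ?_ ?_
    · rw [coe_image, coe_image, coe_image, hU, Set.image_union]
    · rw [coe_image, coe_image, coe_image, hI, Set.image_inter g.injective]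
  cont := hφ.cont.comp (continuous_image g)
  contDiffOn := fun K => by
    rw [profile_image]
    have := (contDiffOn_shift hφ (image g.linear.toAffineEquiv K) (g 0)).comp_continuousLinearMap
      (liftLin g)
    rwa [preimage_strip] at this
  tendsto := fun K G hG j hj => by
    have hcont : Continuous fun p : ℝ × V => ((0, g 0) : ℝ × V) + liftLin g p :=
      continuous_const.add (liftLin g).continuous
    set G' : Set V := Prod.snd '' ((fun p : ℝ × V => ((0, g 0) : ℝ × V) + liftLin g p) ''
      ((Icc 0 1 : Set ℝ) ×ˢ G)) with hG'
    have hG'c : IsCompact G' := ((isCompact_Icc.prod hG).image hcont).image continuous_snd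
    have hmaps : ∀ p ∈ (Icc 0 1 : Set ℝ) ×ˢ G,
        ((0, g 0) : ℝ × V) + liftLin g p ∈ (Icc 0 1 : Set ℝ) ×ˢ G' := by
      intro p hp
      refine ⟨?_, mem_image_of_mem _ (mem_image_of_mem _ hp)⟩
      have : (((0, g 0) : ℝ × V) + liftLin g p).1 = p.1 := by simp [liftLin]
      rw [this]
      exact hp.1
    have h0 := Metric.tendstoUniformlyOn_iff.1
      (hφ.tendsto (image g.linear.toAffineEquiv K) G' hG'c j hj)
    rw [Metric.tendstoUniformlyOn_iff]
    intro ε hε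
    set M : ℝ := ‖liftLin g‖ ^ j + 1 with hM
    have hMpos : 0 < M := by positivity
    have h1 := ((continuous_image (V := V) g.linear.toAffineEquiv).tendsto K).eventually
      (h0 (ε / M) (div_pos hε hMpos))
    filter_upwards [h1] with K' hK' p hp
    rw [jet_image hφ g K hj (mem_strip_of_mem hp), jet_image hφ g K' hj (mem_strip_of_mem hp),
      dist_eq_norm]
    have h2 := hK' _ (hmaps p hp)
    rw [dist_eq_norm] at h2
    set A := jet φ j (image g.linear.toAffineEquiv K) ((0, g 0) + liftLin g p)
    set B := jet φ j (image g.linear.toAffineEquiv K') ((0, g 0) + liftLin g p)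
    have h3 : A.compContinuousLinearMap (fun _ => liftLin g) -
        B.compContinuousLinearMap (fun _ => liftLin g) =
        (A - B).compContinuousLinearMap (fun _ => liftLin g) := by
      ext v; simp
    rw [h3]
    calc ‖(A - B).compContinuousLinearMap (fun _ => liftLin g)‖
        ≤ ‖A - B‖ * ∏ _i : Fin j, ‖liftLin g‖ :=
          ContinuousMultilinearMap.norm_compContinuousLinearMap_le _ _
      _ = ‖A - B‖ * ‖liftLin g‖ ^ j := by simp
      _ ≤ ‖A - B‖ * M := by gcongr; linarith
      _ < ε / M * M := by gcongr
      _ = ε := by field_simp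

variable (V) in
/-- The natural representation of the group `Aff(V)` of affine automorphisms of `V` on `QV(V)`,
`(gφ)(K) = φ(g⁻¹K)`. -/
def affRep : Representation ℂ (V ≃ᵃ[ℝ] V) (QV V) where
  toFun g :=
    { toFun := fun φ => ⟨fun K => φ (image g⁻¹ K), φ.isQuasiSmooth.comp_image g⁻¹⟩
      map_add' := fun _ _ => rfl
      map_smul' := fun _ _ => rfl }
  map_one' := by
    ext φ K
    change φ (image 1⁻¹ K) = φ K
    refine congrArg (φ : ConvexBody V → ℂ) (ConvexBody.ext ?_)
    rw [coe_image, inv_one]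
    exact Set.image_id _
  map_mul' g h := by
    ext φ K
    change φ (image (g * h)⁻¹ K) = φ (image h⁻¹ (image g⁻¹ K))
    refine congrArg (φ : ConvexBody V → ℂ) (ConvexBody.ext ?_)
    rw [coe_image, coe_image, coe_image, mul_inv_rev, AffineEquiv.coe_mul, Set.image_comp]

theorem affRep_apply (g : V ≃ᵃ[ℝ] V) (φ : QV V) (K : ConvexBody V) :
    affRep V g φ K = φ (image g⁻¹ K) := rfl

end Action

/-! ### Smooth maps into a locally convex space -/

section Smooth

variable {E F : Type*} [NormedAddCommGroup E] [NormedSpace ℝ E]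
  [AddCommGroup F] [Module ℝ F] [TopologicalSpace F]

/-- `C^k` maps from an open subset `U` of a finite dimensional space `E` to a topological vector
space `F`: all iterated partial derivatives of order at most `k` exist on `U` and are
continuous there. -/
def IsCkOn (U : Set E) : ℕ → (E → F) → Prop
  | 0, f => ContinuousOn f U
  | k + 1, f => ContinuousOn f U ∧ ∀ v : E, ∃ f' : E → F,
      (∀ x ∈ U, Tendsto (fun t : ℝ => t⁻¹ • (f (x + t • v) - f x)) (𝓝[≠] 0) (𝓝 (f' x))) ∧
        IsCkOn U k f'

/-- Infinitely differentiable maps from an open subset of a finite dimensional space to a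
topological vector space. -/
def IsSmoothOn (U : Set E) (f : E → F) : Prop := ∀ k, IsCkOn U k f

theorem isCkOn_const (U : Set E) (k : ℕ) (c : F) : IsCkOn U k (fun _ => c) := by
  induction k generalizing c with
  | zero => exact continuousOn_const
  | succ k ih =>
    refine ⟨continuousOn_const, fun v => ⟨fun _ => 0, fun x _ => ?_, ih 0⟩⟩
    simpa using tendsto_const_nhds

theorem IsCkOn.add [ContinuousAdd F] {U : Set E} {k : ℕ} {f g : E → F} (hf : IsCkOn U k f)
    (hg : IsCkOn U k g) : IsCkOn U k (f + g) := by
  induction k generalizing f g with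
  | zero => exact ContinuousOn.add hf hg
  | succ k ih =>
    refine ⟨hf.1.add hg.1, fun v => ?_⟩
    obtain ⟨f', hf', hf''⟩ := hf.2 v
    obtain ⟨g', hg', hg''⟩ := hg.2 v
    refine ⟨f' + g', fun x hx => ((hf' x hx).add (hg' x hx)).congr fun t => ?_, ih hf'' hg''⟩
    simp only [Pi.add_apply, ← smul_add]
    congr 1
    abel

theorem IsCkOn.const_smul {R : Type*} [Monoid R] [DistribMulAction R F] [SMulCommClass ℝ R F]
    [ContinuousConstSMul R F] {U : Set E} {k : ℕ} {f : E → F} (c : R) (hf : IsCkOn U k f) :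
    IsCkOn U k (c • f) := by
  induction k generalizing f with
  | zero => exact ContinuousOn.const_smul hf c
  | succ k ih =>
    refine ⟨hf.1.const_smul c, fun v => ?_⟩
    obtain ⟨f', hf', hf''⟩ := hf.2 v
    refine ⟨c • f', fun x hx => ((hf' x hx).const_smul c).congr fun t => ?_, ih hf''⟩
    simp only [Pi.smul_apply, ← smul_sub]
    exact (smul_comm (t⁻¹) c _).symm

end Smooth

/-! ### Smooth valuations and the filtration -/

section SmoothValuations

variable (V : Type*) [NormedAddCommGroup V] [NormedSpace ℝ V]

/-- The open set of all `(A, b) ∈ End(V) × V` with `A` invertible. It is identified with the Lie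
group `Aff(V)` by letting `(A, b)` correspond to the map `x ↦ Ax + b`. -/
def affChart : Set ((V →L[ℝ] V) × V) := {p | IsUnit p.1}

variable {V}

open Classical in
/-- The affine automorphism `x ↦ Ax + b` for `(A, b) ∈ affChart V` (and the identity for all other
pairs). -/
def affOf (p : (V →L[ℝ] V) × V) : V ≃ᵃ[ℝ] V :=
  if h : IsUnit p.1 then
    (ContinuousLinearEquiv.unitsEquiv ℝ V h.unit).toLinearEquiv.toAffineEquiv.trans
      (AffineEquiv.constVAdd ℝ V p.2)
  else AffineEquiv.refl ℝ V

theorem affOf_apply {p : (V →L[ℝ] V) × V} (hp : p ∈ affChart V) (x : V) :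
    affOf p x = p.1 x + p.2 := by
  have h : IsUnit p.1 := hp
  rw [affOf, dif_pos h, add_comm]
  rfl

theorem bijOn_affOf [FiniteDimensional ℝ V] :
    BijOn (affOf : (V →L[ℝ] V) × V → V ≃ᵃ[ℝ] V) (affChart V) univ := by
  refine ⟨fun _ _ => trivial, fun p hp q hq hpq => ?_, fun g _ => ?_⟩
  · have h : ∀ x, p.1 x + p.2 = q.1 x + q.2 := fun x => by
      rw [← affOf_apply hp, ← affOf_apply hq, hpq]
    have h0 : p.2 = q.2 := by simpa using h 0
    refine Prod.ext (ContinuousLinearMap.ext fun x => ?_) h0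
    have := h x
    rwa [h0, add_left_inj] at this
  · have hu : IsUnit (LinearMap.toContinuousLinearMap (g.linear : V →ₗ[ℝ] V)) :=
      ⟨(ContinuousLinearEquiv.unitsEquiv ℝ V).symm g.linear.toContinuousLinearEquiv, rfl⟩
    refine ⟨(LinearMap.toContinuousLinearMap (g.linear : V →ₗ[ℝ] V), g 0), hu, ?_⟩
    ext x
    rw [affOf_apply hu]
    have := g.map_vadd 0 x
    simpa using this.symm

variable (V) [FiniteDimensional ℝ V]

/-- The space `SV(V)` of smooth valuations: the `Aff(V)`-smooth vectors of `QV(V)`, i.e. those `φ`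
for which the orbit map `g ↦ gφ` from `Aff(V)` to `QV(V)` is infinitely differentiable. -/
def SV : Submodule ℂ (QV V) where
  carrier := {φ | IsSmoothOn (affChart V) fun p => affRep V (affOf p) φ}
  zero_mem' := fun k => by
    simpa only [map_zero] using isCkOn_const (affChart V) k (0 : QV V)
  add_mem' := fun {φ ψ} hφ hψ k => by
    have h := (hφ k).add (hψ k)
    have e : (fun p => affRep V (affOf p) (φ + ψ)) =
      (fun p => affRep V (affOf p) φ) + fun p => affRep V (affOf p) ψ := by
        funext p; exact map_add _ _ _
    simpa only [e] using h
  smul_mem' := fun c φ hφ k => by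
    have h := (hφ k).const_smul c
    have e : (fun p => affRep V (affOf p) (c • φ)) = c • fun p => affRep V (affOf p) φ := by
        funext p; exact map_smul _ _ _
    simpa only [e] using h

/-- The filtration `W_i`: the smooth valuations `φ` such that
`(d/dt)^k φ(tK + x) = 0` at `t = 0` for all `k < i`, all convex bodies `K` and all `x ∈ V`.
As `tK + x` is considered for `t ∈ [0,1]`, the derivatives at `0` are one-sided. -/
def W (i : ℕ) : Set (SV V) :=
  {φ | ∀ k < i, ∀ (K : ConvexBody V) (x : V),
    iteratedDerivWithin k (fun t : ℝ => (φ : QV V) (dilTrans K (t, x))) (Icc 0 1) 0 = 0}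

end SmoothValuations

end ConvexVal

end

/-! A quasi-smooth valuation whose `t`-derivatives at `0` vanish up to order `n = dim V` satisfies
`φ(tK + x) = o(t ^ n)`, uniformly for `K` and `x` in a compact set. This is too small to survive a
subdivision: a coordinate grid cuts `K` into at most `(2N + 1) ^ n` pieces, each a translate of a
`1/N`-dilate of a body in a fixed compact set `Q`. Additivity gives `‖φ K‖ ≤ (2N + 1) ^ n * ε * N⁻¹
^ n ≤ 3 ^ n * ε` for large `N`, and `ε` is arbitrary.

The valuation identity also produces the sections by the cutting hyperplanes. They lie in cells of
the same mesh, so they obey the same bound and only enlarge the count; no finer inclusion-exclusion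
is needed. This is `IsValuation.norm_extend_le_of_grid`.

The uniform smallness is `IsQuasiSmooth.exists_norm_dilTrans_le`. It combines the continuity of `K ↦
jet φ n K`, the compactness of the family of bodies inside a compact set, and integration of the
`n`-th derivative from `0`. -/

namespace ConvexVal

/-! ### Cutting convex bodies by hyperplanes and grids -/

section Cutting

variable {V : Type*} [NormedAddCommGroup V] [NormedSpace ℝ V]

open Classical in
/-- The extension by zero of a function on convex bodies to all subsets of `V`. -/
noncomputable def extend (φ : ConvexBody V → ℂ) (S : Set V) : ℂ :=
  if h : Convex ℝ S ∧ IsCompact S ∧ S.Nonempty then φ ⟨S, h.1, h.2.1, h.2.2⟩ else 0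

theorem extend_coe (φ : ConvexBody V → ℂ) (K : ConvexBody V) : extend φ (K : Set V) = φ K :=
  dif_pos ⟨K.convex, K.isCompact, K.nonempty⟩

/-- This default value keeps the cutting identity valid when the hyperplane misses the set, so grid
arguments need not track which cells are empty. -/
theorem extend_empty (φ : ConvexBody V → ℂ) : extend φ ∅ = 0 :=
  dif_neg fun h => Set.not_nonempty_empty h.2.2

theorem exists_body {S : Set V} (hc : Convex ℝ S) (hk : IsCompact S) (hn : S.Nonempty) :
    ∃ K : ConvexBody V, (K : Set V) = S :=
  ⟨⟨S, hc, hk, hn⟩, rfl⟩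

/-- Cutting a compact convex set by a hyperplane. -/
theorem IsValuation.extend_cut {φ : ConvexBody V → ℂ} (hφ : IsValuation φ) {S : Set V}
    (hc : Convex ℝ S) (hk : IsCompact S) (l : V →L[ℝ] ℝ) (c : ℝ) :
    extend φ S = extend φ (S ∩ {x | l x ≤ c}) + extend φ (S ∩ {x | c ≤ l x}) -
      extend φ (S ∩ {x | l x = c}) := by
  rcases (S ∩ {x | l x ≤ c}).eq_empty_or_nonempty with h1 | h1
  · have h2 : S ∩ {x | c ≤ l x} = S := inter_eq_left.2 fun x hx => by
      by_contra h
      exact notMem_empty x (h1.subset ⟨hx, (not_le.1 h : l x < c).le⟩)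
    have h3 : S ∩ {x | l x = c} = ∅ :=
      subset_empty_iff.1 (h1 ▸ inter_subset_inter_right S fun x hx => le_of_eq hx)
    rw [h1, h2, h3, extend_empty]; ring
  rcases (S ∩ {x | c ≤ l x}).eq_empty_or_nonempty with h2 | h2
  · have h2' : S ∩ {x | l x ≤ c} = S := inter_eq_left.2 fun x hx => by
      by_contra h
      exact notMem_empty x (h2.subset ⟨hx, (not_le.1 h : c < l x).le⟩)
    have h3 : S ∩ {x | l x = c} = ∅ :=
      subset_empty_iff.1 (h2 ▸ inter_subset_inter_right S fun x hx => ge_of_eq hx)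
    rw [h2, h2', h3, extend_empty]; ring
  -- With points on both sides, connectedness of `S` puts a point on the hyperplane, so the section
  -- is a genuine body.
  have h3 : (S ∩ {x | l x = c}).Nonempty := by
    obtain ⟨x, hx, hxc⟩ := h1
    obtain ⟨y, hy, hyc⟩ := h2
    obtain ⟨z, hz, hzc⟩ := hc.isPreconnected.intermediate_value hx hy l.continuous.continuousOn
      ⟨hxc, hyc⟩
    exact ⟨z, hz, hzc⟩
  obtain ⟨K, hK⟩ : ∃ K : ConvexBody V, (K : Set V) = S ∩ {x | l x ≤ c} := exists_body (hc.inter (convex_halfSpace_le l.toLinearMap.isLinear c))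
    (hk.inter_right (isClosed_le l.continuous continuous_const)) h1
  obtain ⟨L, hL⟩ : ∃ L : ConvexBody V, (L : Set V) = S ∩ {x | c ≤ l x} := exists_body (hc.inter (convex_halfSpace_ge l.toLinearMap.isLinear c))
    (hk.inter_right (isClosed_le continuous_const l.continuous)) h2
  obtain ⟨I, hI⟩ : ∃ I : ConvexBody V, (I : Set V) = S ∩ {x | l x = c} := exists_body (hc.inter (convex_hyperplane l.toLinearMap.isLinear c))
    (hk.inter_right (isClosed_eq l.continuous continuous_const)) h3
  obtain ⟨U, hU⟩ := exists_body hc hk (h1.mono inter_subset_left)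
  rw [← hK, ← hL, ← hI, ← hU]
  simp only [extend_coe]
  refine hφ K L U I ?_ ?_
  · rw [hU, hK, hL, ← inter_union_distrib_left, eq_comm, inter_eq_left]
    exact fun x _ => le_total (l x) c
  · rw [hI, hK, hL, ← inter_inter_distrib_left]
    congr 1
    ext x
    exact le_antisymm_iff

/-- Slicing by parallel hyperplanes: a bound on the pieces of width `h` gives a bound on the pieces
of width `N * h`. -/
theorem IsValuation.norm_extend_le_of_slices {φ : ConvexBody V → ℂ} (hφ : IsValuation φ)
    (P : Set V → Prop) (hP : ∀ S T : Set V, P S → T ⊆ S → P T) (l : V →L[ℝ] ℝ) {h B : ℝ}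
    (hh : 0 ≤ h)
    (hB : ∀ S, Convex ℝ S → IsCompact S → P S → (∃ a, ∀ x ∈ S, l x ∈ Icc a (a + h)) →
      ‖extend φ S‖ ≤ B) (N : ℕ) :
    ∀ S, Convex ℝ S → IsCompact S → P S → (∃ a, ∀ x ∈ S, l x ∈ Icc a (a + N * h)) →
      ‖extend φ S‖ ≤ (2 * N + 1) * B := by
  induction N with
  | zero =>
    rintro S hc hk hS ⟨a, ha⟩
    have := hB S hc hk hS ⟨a, fun x hx => ⟨(ha x hx).1, (ha x hx).2.trans (by simpa using hh)⟩⟩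
    simpa using this
  | succ N ih =>
    rintro S hc hk hS ⟨a, ha⟩
    -- Split off the last slice. The slice and the section, which has width `0 ≤ h`, cost `B` each,
    -- hence the increment `2` in `2 * N + 1`.
    have h1 := ih (S ∩ {x | l x ≤ a + N * h}) (hc.inter (convex_halfSpace_le l.toLinearMap.isLinear _))
      (hk.inter_right (isClosed_le l.continuous continuous_const)) (hP _ _ hS inter_subset_left)
      ⟨a, fun x hx => ⟨(ha x hx.1).1, hx.2⟩⟩
    have h2 := hB (S ∩ {x | a + N * h ≤ l x}) (hc.inter (convex_halfSpace_ge l.toLinearMap.isLinear _))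
      (hk.inter_right (isClosed_le continuous_const l.continuous)) (hP _ _ hS inter_subset_left)
      ⟨a + N * h, fun x hx => ⟨hx.2, by
        have := (ha x hx.1).2
        push_cast at this
        linarith⟩⟩
    have h3 := hB (S ∩ {x | l x = a + N * h}) (hc.inter (convex_hyperplane l.toLinearMap.isLinear _))
      (hk.inter_right (isClosed_eq l.continuous continuous_const)) (hP _ _ hS inter_subset_left)
      ⟨a + N * h, fun x hx => ⟨ge_of_eq hx.2, (le_of_eq hx.2).trans (by linarith)⟩⟩
    rw [hφ.extend_cut hc hk l (a + N * h)]
    refine ((norm_sub_le _ _).trans (add_le_add (norm_add_le _ _) le_rfl)).trans ?_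
    push_cast
    linarith

/-- Cutting along a grid: a bound on the subsets of cells of mesh `h` gives a bound on the subsets
of boxes of side length `N * h`. -/
theorem IsValuation.norm_extend_le_of_grid {φ : ConvexBody V → ℂ} (hφ : IsValuation φ)
    {ι : Type*} (l : ι → V →L[ℝ] ℝ) (G : Set V) {h B : ℝ} (hh : 0 ≤ h) (N : ℕ)
    (hB : ∀ S, Convex ℝ S → IsCompact S → S ⊆ G →
      (∀ i, ∃ a, ∀ x ∈ S, l i x ∈ Icc a (a + h)) → ‖extend φ S‖ ≤ B) (s : Finset ι) :
    ∀ S, Convex ℝ S → IsCompact S → S ⊆ G →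
      (∀ i, i ∉ s → ∃ a, ∀ x ∈ S, l i x ∈ Icc a (a + h)) →
      (∀ i, ∃ a, ∀ x ∈ S, l i x ∈ Icc a (a + N * h)) →
      ‖extend φ S‖ ≤ (2 * N + 1) ^ s.card * B := by
  classical
  induction s using Finset.induction_on with
  | empty =>
    intro S hc hk hS h1 _
    simpa using hB S hc hk hS fun i => h1 i (Finset.notMem_empty i)
  | insert j s hj ih =>
    intro S hc hk hS h1 h2
    rw [Finset.card_insert_of_notMem hj, pow_succ', mul_assoc]
    -- All remaining constraints pass to subsets, so they can be carried as the predicate `P` while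
    -- slicing in direction `j`. Each slice is then narrow in direction `j` too, and the induction
    -- hypothesis for `s` applies to it.
    refine hφ.norm_extend_le_of_slices
      (fun S => S ⊆ G ∧ (∀ i, i ∉ insert j s → ∃ a, ∀ x ∈ S, l i x ∈ Icc a (a + h)) ∧
        ∀ i, ∃ a, ∀ x ∈ S, l i x ∈ Icc a (a + N * h))
      (fun S T hS hT => ⟨hT.trans hS.1,
        fun i hi => (hS.2.1 i hi).imp fun a ha x hx => ha x (hT hx),
        fun i => (hS.2.2 i).imp fun a ha x hx => ha x (hT hx)⟩)
      (l j) hh (fun T hc hk hT hj' => ih T hc hk hT.1 (fun i hi => ?_) hT.2.2) N S hc hk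
      ⟨hS, h1, h2⟩ (h2 j)
    by_cases hij : i = j
    · exact hij ▸ hj'
    · exact hT.2.1 i (by simp [hij, hi])

end Cutting

/-! ### Uniform vanishing order at `t = 0` and conclusion -/

section Vanishing

variable {V : Type*} [NormedAddCommGroup V] [NormedSpace ℝ V]

/-- A function all of whose derivatives of order less than `n` vanish at `0` is bounded by `ε t ^ n`
if its `n`-th derivative is bounded by `ε`. -/
theorem norm_le_mul_pow_of_iteratedDerivWithin {f : ℝ → ℂ} {n : ℕ}
    (hf : ContDiffOn ℝ n f (Icc 0 1)) (h0 : ∀ k < n, iteratedDerivWithin k f (Icc 0 1) 0 = 0)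
    {δ ε : ℝ} (hδ : δ ≤ 1) (hε : 0 ≤ ε)
    (hn : ∀ t ∈ Icc 0 δ, ‖iteratedDerivWithin n f (Icc 0 1) t‖ ≤ ε) {t : ℝ} (ht : t ∈ Icc 0 δ) :
    ‖f t‖ ≤ ε * t ^ n := by
  -- Descend from order `n` to order `0`. On `[0, t]` the next derivative is at most `ε * t ^ k`, so
  -- the mean value inequality from the zero value at `0` gains one factor `t`; the factorial of
  -- Taylor's formula is not needed.
  have key : ∀ k ≤ n, ∀ t ∈ Icc 0 δ,
      ‖iteratedDerivWithin (n - k) f (Icc 0 1) t‖ ≤ ε * t ^ k := by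
    intro k
    induction k with
    | zero => simpa using hn
    | succ k ih =>
      intro hk t ht
      have hsub : Icc 0 t ⊆ Icc (0 : ℝ) 1 := Icc_subset_Icc_right (ht.2.trans hδ)
      have hlt : n - (k + 1) < n := by omega
      have hd : ∀ s ∈ Icc 0 t, HasDerivWithinAt (iteratedDerivWithin (n - (k + 1)) f (Icc 0 1))
          (iteratedDerivWithin (n - k) f (Icc 0 1) s) (Icc 0 t) s := by
        intro s hs
        have h1 := (hf.differentiableOn_iteratedDerivWithin (by exact_mod_cast hlt)
          (uniqueDiffOn_Icc zero_lt_one) s (hsub hs)).hasDerivWithinAt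
        have h2 : n - k = n - (k + 1) + 1 := by omega
        rw [h2, iteratedDerivWithin_succ]
        exact h1.mono hsub
      have hb : ∀ s ∈ Icc 0 t, ‖iteratedDerivWithin (n - k) f (Icc 0 1) s‖ ≤ ε * t ^ k := by
        intro s hs
        refine (ih (by omega) s ⟨hs.1, hs.2.trans ht.2⟩).trans ?_
        exact mul_le_mul_of_nonneg_left (pow_le_pow_left₀ hs.1 hs.2 k) hε
      have h3 := (convex_Icc 0 t).norm_image_sub_le_of_norm_hasDerivWithin_le hd hb
        (left_mem_Icc.2 ht.1) (right_mem_Icc.2 ht.1)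
      rw [h0 _ hlt, sub_zero, sub_zero, Real.norm_of_nonneg ht.1] at h3
      rwa [pow_succ, ← mul_assoc]
  simpa using key n le_rfl t ht

/-- The derivatives of `t ↦ φ(tK + x)` in terms of the total derivatives. -/
theorem iteratedDerivWithin_dilTrans {φ : ConvexBody V → ℂ} (hφ : IsQuasiSmooth φ) {j : ℕ}
    (hj : j ≤ Module.finrank ℝ V) (K : ConvexBody V) (x : V) {t : ℝ} (ht : t ∈ Icc (0 : ℝ) 1) :
    iteratedDerivWithin j (fun t : ℝ => φ (dilTrans K (t, x))) (Icc 0 1) t =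
      jet φ j K (t, x) (fun _ => (1, 0)) := by
  have hj' : (j : WithTop ℕ∞) ≤ (Module.finrank ℝ V : ℕ) := by exact_mod_cast hj
  have hpre : (ContinuousLinearMap.inl ℝ ℝ V) ⁻¹' strip V = Icc 0 1 := by
    ext s; simp [strip]
  -- Chain rule for the linear inclusion `t ↦ (t, 0)`; the base point `x` is absorbed into a
  -- translation, which preserves the strip.
  have h := ContinuousLinearMap.iteratedFDerivWithin_comp_right (ContinuousLinearMap.inl ℝ ℝ V)
    (contDiffOn_shift hφ K x) uniqueDiffOn_strip
    (by rw [hpre]; exact uniqueDiffOn_Icc zero_lt_one) (x := t)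
    (by rw [← mem_preimage, hpre]; exact ht) hj'
  have hs : ((0, x) : ℝ × V) +ᵥ strip V = strip V := by
    ext q
    rw [Set.mem_vadd_set_iff_neg_vadd_mem]
    simp [strip]
  rw [hpre, iteratedFDerivWithin_comp_add_left, hs] at h
  have hfun : (fun t : ℝ => φ (dilTrans K (t, x))) =
      (fun q => profile φ K ((0, x) + q)) ∘ ContinuousLinearMap.inl ℝ ℝ V := by
    funext s
    simp [profile]
  rw [iteratedDerivWithin_eq_iteratedFDerivWithin, hfun, h]
  simp [jet]

/-- The top order derivatives of a quasi-smooth valuation are small near `t = 0`, uniformly on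
compact sets, if they vanish at `t = 0`. -/
theorem IsQuasiSmooth.exists_iteratedDerivWithin_le {φ : ConvexBody V → ℂ} (hφ : IsQuasiSmooth φ)
    (h0 : ∀ (K : ConvexBody V) (x : V), iteratedDerivWithin (Module.finrank ℝ V)
      (fun t : ℝ => φ (dilTrans K (t, x))) (Icc 0 1) 0 = 0)
    {G : Set V} (hG : IsCompact G) {ε : ℝ} (hε : 0 < ε) :
    ∃ δ > 0, δ ≤ 1 ∧ ∀ K : ConvexBody V, (K : Set V) ⊆ G → ∀ x ∈ G, ∀ t ∈ Icc 0 δ,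
      ‖iteratedDerivWithin (Module.finrank ℝ V) (fun t : ℝ => φ (dilTrans K (t, x)))
        (Icc 0 1) t‖ ≤ ε := by
  set n := Module.finrank ℝ V with hn
  let e : Fin n → ℝ × V := fun _ => (1, 0)
  -- The vector `(1, 0)` has norm one in the product norm.
  have hle : ∀ A : ContinuousMultilinearMap ℝ (fun _ : Fin n => ℝ × V) ℂ, ‖A e‖ ≤ ‖A‖ := by
    intro A
    refine (A.le_opNorm e).trans (le_of_eq ?_)
    simp [e, Prod.norm_def]
  have hjet : ∀ (K : ConvexBody V) (x : V), ∀ t ∈ Icc (0 : ℝ) 1,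
      iteratedDerivWithin n (fun t : ℝ => φ (dilTrans K (t, x))) (Icc 0 1) t =
        jet φ n K (t, x) e := fun K x t ht => iteratedDerivWithin_dilTrans hφ le_rfl K x ht
  -- Two errors of `ε / 2`: from `K'` to `K` by continuity of the jet in the body, and from `t` to
  -- `0` by uniform continuity of the jet of `K` on a compact set.
  have hloc : ∀ K : ConvexBody V, ∃ s ∈ 𝓝 K, ∃ δ > 0, δ ≤ 1 ∧ ∀ K' ∈ s, ∀ x ∈ G,
      ∀ t ∈ Icc 0 δ, ‖jet φ n K' (t, x) e‖ ≤ ε := by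
    intro K
    have hc : ContinuousOn (jet φ n K) (strip V) :=
      (hφ.contDiffOn K).continuousOn_iteratedFDerivWithin le_rfl uniqueDiffOn_strip
    have hu := (isCompact_Icc.prod hG).uniformContinuousOn_of_continuous
      (hc.mono fun p hp => mem_strip_of_mem hp)
    obtain ⟨δ, hδ, hu⟩ := Metric.uniformContinuousOn_iff.1 hu (ε / 2) (half_pos hε)
    refine ⟨_, Metric.tendstoUniformlyOn_iff.1 (hφ.tendsto K G hG n le_rfl) (ε / 2) (half_pos hε),
      min 1 (δ / 2), by positivity, min_le_left _ _, fun K' hK' x hx t ht => ?_⟩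
    have ht1 : t ∈ Icc (0 : ℝ) 1 := ⟨ht.1, ht.2.trans (min_le_left _ _)⟩
    have h1 := hK' (t, x) ⟨ht1, hx⟩
    have h2 := hu (t, x) ⟨ht1, hx⟩ (0, x) ⟨left_mem_Icc.2 zero_le_one, hx⟩ (by
      rw [Prod.dist_eq, dist_self, max_eq_left dist_nonneg, Real.dist_eq, sub_zero,
        abs_of_nonneg ht.1]
      exact (ht.2.trans (min_le_right _ _)).trans_lt (half_lt_self hδ))
    -- The hypothesis kills only the pure `t`-component of the jet, so the comparison is made after
    -- evaluation at `e`.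
    have h3 : jet φ n K (0, x) e = 0 := by
      rw [← hjet K x 0 (left_mem_Icc.2 zero_le_one), h0]
    have h4 : ‖(jet φ n K' (t, x) - jet φ n K (0, x)) e‖ ≤ ε := by
      refine (hle _).trans ?_
      rw [← dist_eq_norm]
      rw [dist_comm] at h1
      linarith [dist_triangle (jet φ n K' (t, x)) (jet φ n K (t, x)) (jet φ n K (0, x))]
    rwa [_root_.sub_apply, h3, sub_zero] at h4
  -- Blaschke selection makes one `δ` serve all bodies in `G`.
  obtain ⟨δ, hδ, hδ1, h⟩ := (isCompact_bodies_subset hG).induction_on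
    (p := fun s => ∃ δ > 0, δ ≤ 1 ∧ ∀ K' ∈ s, ∀ x ∈ G, ∀ t ∈ Icc 0 δ, ‖jet φ n K' (t, x) e‖ ≤ ε)
    ⟨1, one_pos, le_rfl, fun _ h => h.elim⟩
    (fun s t hst ⟨δ, hδ, hδ1, h⟩ => ⟨δ, hδ, hδ1, fun K' hK' => h K' (hst hK')⟩)
    (fun s s' ⟨δ, hδ, hδ1, h⟩ ⟨δ', hδ', _, h'⟩ => ⟨min δ δ', lt_min hδ hδ',
      (min_le_left _ _).trans hδ1, fun K' hK' x hx t ht => hK'.elim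
        (fun hs => h K' hs x hx t ⟨ht.1, ht.2.trans (min_le_left _ _)⟩)
        (fun hs => h' K' hs x hx t ⟨ht.1, ht.2.trans (min_le_right _ _)⟩)⟩)
    (fun K _ => by
      obtain ⟨s, hs, h⟩ := hloc K
      exact ⟨s, mem_nhdsWithin_of_mem_nhds hs, h⟩)
  refine ⟨δ, hδ, hδ1, fun K hK x hx t ht => ?_⟩
  rw [hjet K x t ⟨ht.1, ht.2.trans hδ1⟩]
  exact h K hK x hx t ht

/-- If the derivatives of order at most `n = dim V` at `t = 0` vanish, then `φ(tK + x) = o(t ^ n)`,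
uniformly on compact sets. -/
theorem IsQuasiSmooth.exists_norm_dilTrans_le {φ : ConvexBody V → ℂ} (hφ : IsQuasiSmooth φ)
    (h0 : ∀ k ≤ Module.finrank ℝ V, ∀ (K : ConvexBody V) (x : V), iteratedDerivWithin k
      (fun t : ℝ => φ (dilTrans K (t, x))) (Icc 0 1) 0 = 0)
    {G : Set V} (hG : IsCompact G) {ε : ℝ} (hε : 0 < ε) :
    ∃ δ > 0, ∀ K : ConvexBody V, (K : Set V) ⊆ G → ∀ x ∈ G, ∀ t ∈ Icc 0 δ,
      ‖φ (dilTrans K (t, x))‖ ≤ ε * t ^ Module.finrank ℝ V := by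
  obtain ⟨δ, hδ, hδ1, h⟩ := hφ.exists_iteratedDerivWithin_le (h0 _ le_rfl) hG hε
  refine ⟨δ, hδ, fun K hK x hx t ht => ?_⟩
  refine norm_le_mul_pow_of_iteratedDerivWithin (f := fun t : ℝ => φ (dilTrans K (t, x))) ?_
    (fun k hk => h0 k hk.le K x) hδ1 hε.le (h K hK x hx) ht
  exact (hφ.contDiffOn K).comp (contDiff_id.prodMk contDiff_const).contDiffOn
    fun s hs => ⟨hs, trivial⟩

/-- A quasi-smooth valuation such that `φ(tK + x)` vanishes at `t = 0` to order greater than `dim V`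
is zero. -/
theorem IsQuasiSmooth.eq_zero_of_iteratedDerivWithin [FiniteDimensional ℝ V]
    {φ : ConvexBody V → ℂ} (hφ : IsQuasiSmooth φ)
    (h0 : ∀ k ≤ Module.finrank ℝ V, ∀ (K : ConvexBody V) (x : V), iteratedDerivWithin k
      (fun t : ℝ => φ (dilTrans K (t, x))) (Icc 0 1) 0 = 0) (K : ConvexBody V) : φ K = 0 := by
  set n := Module.finrank ℝ V with hn
  let b := Module.finBasis ℝ V
  let l : Fin n → V →L[ℝ] ℝ := fun i => LinearMap.toContinuousLinearMap (b.coord i)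
  have hbdd : ∃ R > 0, ∀ x ∈ K, ∀ i, |l i x| ≤ R := by
    have : ∀ i, ∃ C, ∀ x ∈ K, |l i x| ≤ C := fun i =>
      K.isCompact.exists_bound_of_continuousOn (l i).continuous.continuousOn
    choose C hC using this
    refine ⟨∑ i, |C i| + 1, by positivity, fun x hx i => ?_⟩
    have h1 := Finset.single_le_sum (f := fun i => |C i|) (fun i _ => abs_nonneg _)
      (Finset.mem_univ i)
    have h2 := (hC i x hx).trans (le_abs_self _)
    linarith
  obtain ⟨R, hR, hKR⟩ := hbdd
  -- A cell of mesh `2 * R / N`, moved so that one of its points is the origin and blown up by `N`,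
  -- has coordinates at most `2 * R` in absolute value. As `Q` does not depend on `N`, `δ` can be
  -- fixed before `N`.
  let Q : Set V := {x | ∀ i, |l i x| ≤ 2 * R}
  have hQ : IsCompact Q := by
    have h1 := (isCompact_univ_pi fun _ : Fin n => isCompact_Icc (a := -(2 * R)) (b := 2 * R))
    have h2 := h1.image b.equivFunL.symm.continuous
    convert h2 using 1
    ext x
    rw [← ContinuousLinearEquiv.coe_toHomeomorph, Homeomorph.image_eq_preimage_symm]
    simp [Q, l, n, abs_le, Pi.le_def, forall_and]
  have hKQ : (K : Set V) ⊆ Q := fun x hx i => (hKR x hx i).trans (by linarith)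
  have key : ∀ ε > 0, ‖φ K‖ ≤ 3 ^ n * ε := by
    intro ε hε
    obtain ⟨δ, hδ, h⟩ := hφ.exists_norm_dilTrans_le h0 hQ hε
    obtain ⟨M, hM⟩ := exists_nat_gt (1 / δ)
    -- The successor ensures `N ≥ 1`, used later for `2 * N + 1 ≤ 3 * N`.
    set N := M + 1
    have hN0 : (0 : ℝ) < N := by positivity
    have hN : (N : ℝ)⁻¹ ≤ δ := by
      rw [inv_le_comm₀ hN0 hδ, ← one_div]
      push_cast [N]
      linarith
    have hcell : ∀ S, Convex ℝ S → IsCompact S → S ⊆ (K : Set V) →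
        (∀ i, ∃ a, ∀ x ∈ S, l i x ∈ Icc a (a + 2 * R / N)) →
        ‖extend φ S‖ ≤ ε * (N : ℝ)⁻¹ ^ n := by
      intro S hc hk hS hw
      rcases S.eq_empty_or_nonempty with rfl | hne
      · rw [extend_empty, norm_zero]; positivity
      obtain ⟨L, rfl⟩ := exists_body hc hk hne
      obtain ⟨x, hx⟩ := hne
      -- `L = N⁻¹ • (N • (L - x)) + x`: the small body is a dilate with `t = N⁻¹` of a body that
      -- will be seen to lie in `Q`.
      have hL : dilTrans (dilTrans L (N, -((N : ℝ) • x))) ((N : ℝ)⁻¹, x) = L := by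
        apply ConvexBody.ext
        rw [coe_dilTrans, coe_dilTrans, image_image]
        convert image_id (L : Set V) using 2 with y
        simp [smul_smul, hN0.ne']
      rw [extend_coe, ← hL]
      refine h _ ?_ x (hKQ (hS hx)) _ ⟨by positivity, hN⟩
      rw [coe_dilTrans]
      rintro _ ⟨y, hy, rfl⟩ i
      obtain ⟨a, ha⟩ := hw i
      have h1 := ha x hx
      have h2 := ha y hy
      have h3 : |l i y - l i x| ≤ 2 * R / N := by
        rw [abs_le]; constructor <;> linarith [h1.1, h1.2, h2.1, h2.2]
      have h4 : l i ((N : ℝ) • y + -((N : ℝ) • x)) = N * (l i y - l i x) := by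
        simp only [map_add, map_neg, map_smul, smul_eq_mul]; ring
      simp only
      rw [h4, abs_mul, abs_of_pos hN0]
      rwa [le_div_iff₀' hN0] at h3
    -- With all directions still to be cut, `K` only has to fit in a box of side `N * (2 * R / N) =
    -- 2 * R`, namely `[-R, R]` in each coordinate.
    have hgrid := hφ.valuation.norm_extend_le_of_grid l (K : Set V) (by positivity) N
      hcell Finset.univ K K.convex K.isCompact Subset.rfl
      (fun i hi => absurd (Finset.mem_univ i) hi) (fun i => ⟨-R, fun x hx => by
        have := abs_le.1 (hKR x hx i)
        rw [mul_div_cancel₀ _ hN0.ne']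
        exact ⟨this.1, by linarith [this.2]⟩⟩)
    rw [extend_coe, Finset.card_univ, Fintype.card_fin] at hgrid
    refine hgrid.trans ?_
    have h5 : (2 * (N : ℝ) + 1) ≤ 3 * N := by
      have : (1 : ℝ) ≤ N := by exact_mod_cast Nat.le_add_left 1 M
      linarith
    -- The number of pieces and the size of each cancel exactly in `N`, leaving a bound proportional
    -- to `ε`.
    calc (2 * (N : ℝ) + 1) ^ n * (ε * (N : ℝ)⁻¹ ^ n)
        ≤ (3 * N) ^ n * (ε * (N : ℝ)⁻¹ ^ n) := by gcongr
      _ = 3 ^ n * ε * (N * (N : ℝ)⁻¹) ^ n := by rw [mul_pow, mul_pow]; ring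
      _ = 3 ^ n * ε := by rw [mul_inv_cancel₀ hN0.ne', one_pow, mul_one]
  rw [← norm_le_zero_iff]
  refine le_of_forall_pos_le_add fun ε hε => ?_
  have := key (ε / 3 ^ n) (by positivity)
  rwa [mul_div_cancel₀ _ (by positivity), ← zero_add ε] at this

end Vanishing

end ConvexVal

theorem proposition3p1 (V : Type*) [NormedAddCommGroup V] [NormedSpace ℝ V]
    [FiniteDimensional ℝ V] :
    ConvexVal.W V (Module.finrank ℝ V + 1) = {0} := by
  refine Set.eq_singleton_iff_unique_mem.2 ⟨fun k _ K x => ?_, fun φ hφ => ?_⟩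
  · exact iteratedDerivWithin_fun_const_zero
  · refine Subtype.ext (ConvexVal.QV.ext fun K => ?_)
    exact φ.1.isQuasiSmooth.eq_zero_of_iteratedDerivWithin
      (fun k hk => hφ k (Nat.lt_succ_of_le hk)) K
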